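/- Let $\Bbbk$ be a field. For a finite poset $P$ and an integer $n \ge 0$, let $[n]=\{1<\dots<n\}$ and let the $n$-th letterplace ideal $L(n,P)$ be the ideal of the polynomial ring $\Bbbk[x_{i,p} : (i,p)\in [n]\times P]$ generated by the monomials $x_{1,p_1}x_{2,p_2}\cdots x_{n,p_n}$ with $p_1\le p_2\le\cdots\le p_n$ in $P$ (so $L(0,P)$ is the unit ideal of $\Bbbk$). For a homogeneous ideal $I$ of a polynomial ring $S=\Bbbk[x_\sigma]$ in finitely many variables with the standard grading, let $\beta_{i,j}(I)$ denote its graded Betti numbers: if $I\leftarrow F_0\leftarrow F_1\leftarrow\cdots$ is a minimal graded free resolution of $I$ over $S$, then $F_i\cong\bigoplus_j S(-j)^{\beta_{i,j}(I)}$; put $\beta_{i,j}(I)=0$ for $i<0$. Corollary 4.2. Suppose that the finite poset $P$ has a unique minimal element $a$, and let $n\ge 1$. Then for all integers $i,j$, $$\beta_{i,j}(L(n,P)) = \beta_{i,j}(L(n,P\setminus\{a\})) + \beta_{i,j-1}(L(n-1,P)) + \beta_{i-1,j-1}(L(n,P\setminus\{a\})).$$ Here each Betti number is computed over the polynomial ring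 in which the ideal lives. -/

import Mathlib

/-- For finite posets `Q`, `P`, the ideal `L(Q, P)` of `k[x_{Q × P}]` generated by the monomials
`∏_{q ∈ Q} x_{(q, φ q)}` of the graphs of the isotone maps `φ : Q → P`. -/
noncomputable def posetHomIdeal (k : Type*) [Field k] (Q P : Type*) [Fintype Q] [PartialOrder Q]
    [PartialOrder P] : Ideal (MvPolynomial (Q × P) k) :=
  Ideal.span (Set.range fun φ : Q →o P => ∏ q : Q, MvPolynomial.X (q, φ q))

/-- The `n`-th letterplace ideal `L(n, P) = L([n], P)`; the chain `[n]` is `Fin n`. -/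
noncomputable def letterplaceIdeal (k : Type*) [Field k] (n : ℕ) (P : Type*) [PartialOrder P] :
    Ideal (MvPolynomial (Fin n × P) k) :=
  posetHomIdeal k (Fin n) P

/-- Let `S = k[x_σ]` with its standard grading. The vector `v` is homogeneous of degree `j` in the
graded free module `⨁_c S(-e c)`, i.e. each nonzero entry `v c` is homogeneous of degree
`j - e c`. -/
def IsHomogeneousVec {k : Type*} [Field k] {σ : Type*} {m : ℕ} (e : Fin m → ℕ) (j : ℕ)
    (v : Fin m → MvPolynomial σ k) : Prop :=
  ∀ c, ∀ u ∈ (v c).support, u.degree + e c = j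

/-- A minimal graded free resolution `I ← F₀ ← F₁ ← ⋯` of an ideal `I` of `S = k[x_σ]`, with
`F_i = ⨁_{b < rank i} S(-deg i b)`. -/
structure MinimalGradedFreeResolution {k : Type*} [Field k] {σ : Type*}
    (I : Ideal (MvPolynomial σ k)) where
  /-- the rank of `F_i` -/
  rank : ℕ → ℕ
  /-- the degrees of the basis elements of `F_i` -/
  deg : ∀ i, Fin (rank i) → ℕ
  /-- the map `F₀ → S`, with image `I` -/
  aug : (Fin (rank 0) → MvPolynomial σ k) →ₗ[MvPolynomial σ k] MvPolynomial σ k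
  /-- the differential `F_{i+1} → F_i` -/
  d : ∀ i, (Fin (rank (i + 1)) → MvPolynomial σ k) →ₗ[MvPolynomial σ k]
    (Fin (rank i) → MvPolynomial σ k)
  range_aug : LinearMap.range aug = I
  exact_zero : LinearMap.range (d 0) = LinearMap.ker aug
  exact_succ : ∀ i, LinearMap.range (d (i + 1)) = LinearMap.ker (d i)
  /-- `aug` preserves degrees -/
  aug_homogeneous : ∀ b, (aug (Pi.single b 1)).IsHomogeneous (deg 0 b)
  /-- the differentials preserve degrees -/
  d_homogeneous : ∀ i b, IsHomogeneousVec (deg i) (deg (i + 1) b) (d i (Pi.single b 1))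
  /-- minimality: the entries of the differentials lie in the ideal generated by the variables -/
  minimal : ∀ i b c, MvPolynomial.constantCoeff (d i (Pi.single b 1) c) = 0

section Existence

variable {k : Type*} [Field k] {σ : Type*}

/-- The degree `j` component of a vector in `⨁_c S(-e c)`. -/
noncomputable def vecComponent {m : ℕ} (e : Fin m → ℕ) (j : ℕ) (v : Fin m → MvPolynomial σ k) :
    Fin m → MvPolynomial σ k :=
  fun c => if e c ≤ j then MvPolynomial.homogeneousComponent (j - e c) (v c) else 0

theorem coeff_vecComponent {m : ℕ} (e : Fin m → ℕ) (j : ℕ) (v : Fin m → MvPolynomial σ k)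
    (c : Fin m) (u : σ →₀ ℕ) : (vecComponent e j v c).coeff u =
      if u.degree + e c = j then (v c).coeff u else 0 := by
  unfold vecComponent
  split_ifs with h1 h2 h2
  · rw [MvPolynomial.coeff_homogeneousComponent, if_pos (by omega)]
  · rw [MvPolynomial.coeff_homogeneousComponent, if_neg (by omega)]
  · omega
  · simp

theorem isHomogeneousVec_vecComponent {m : ℕ} (e : Fin m → ℕ) (j : ℕ)
    (v : Fin m → MvPolynomial σ k) : IsHomogeneousVec e j (vecComponent e j v) := by
  intro c u hu
  rw [MvPolynomial.mem_support_iff, coeff_vecComponent] at hu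
  by_contra h
  exact hu (if_neg h)

theorem vecComponent_add {m : ℕ} (e : Fin m → ℕ) (j : ℕ) (v w : Fin m → MvPolynomial σ k) :
    vecComponent e j (v + w) = vecComponent e j v + vecComponent e j w := by
  ext c u
  simp only [coeff_vecComponent, Pi.add_apply, MvPolynomial.coeff_add]
  split_ifs <;> simp

theorem vecComponent_zero {m : ℕ} (e : Fin m → ℕ) (j : ℕ) :
    vecComponent e j (0 : Fin m → MvPolynomial σ k) = 0 := by
  ext c u
  simp [coeff_vecComponent]

theorem IsHomogeneousVec.vecComponent_eq {m : ℕ} {e : Fin m → ℕ} {j : ℕ}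
    {v : Fin m → MvPolynomial σ k} (h : IsHomogeneousVec e j v) (i : ℕ) :
    vecComponent e i v = if i = j then v else 0 := by
  ext c u
  rw [coeff_vecComponent]
  by_cases hu : u ∈ (v c).support
  · have := h c u hu
    by_cases hij : i = j
    · rw [if_pos (by omega), if_pos hij]
    · rw [if_neg (by omega), if_neg hij]; simp
  · rw [MvPolynomial.notMem_support_iff] at hu
    split_ifs <;> simp [hu]

theorem vec_eq_sum_vecComponent {m : ℕ} (e : Fin m → ℕ) (v : Fin m → MvPolynomial σ k) :
    ∃ J, v = ∑ j ∈ Finset.range J, vecComponent e j v := by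
  refine ⟨(Finset.univ.sup fun c => (v c).totalDegree + e c) + 1, ?_⟩
  ext c u
  rw [Finset.sum_apply, MvPolynomial.coeff_sum]
  simp only [coeff_vecComponent]
  by_cases hu : u ∈ (v c).support
  · rw [Finset.sum_ite_eq, if_pos]
    have h1 : u.degree ≤ (v c).totalDegree := by
      exact MvPolynomial.le_totalDegree hu
    have h2 := Finset.le_sup (f := fun c => (v c).totalDegree + e c) (Finset.mem_univ c)
    rw [Finset.mem_range]
    omega
  · rw [MvPolynomial.notMem_support_iff] at hu
    simp [hu]

theorem IsHomogeneousVec.monomial_smul {m : ℕ} {e : Fin m → ℕ} {j : ℕ}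
    {v : Fin m → MvPolynomial σ k} (h : IsHomogeneousVec e j v) (u : σ →₀ ℕ) (a : k) :
    IsHomogeneousVec e (u.degree + j) (MvPolynomial.monomial u a • v) := by
  classical
  intro c w hw
  rw [Pi.smul_apply, smul_eq_mul, MvPolynomial.mem_support_iff,
    MvPolynomial.coeff_monomial_mul'] at hw
  split_ifs at hw with hle
  · have h1 : (v c).coeff (w - u) ≠ 0 := right_ne_zero_of_mul hw
    have h2 := h c _ (MvPolynomial.mem_support_iff.2 h1)
    have h3 : w.degree = (w - u).degree + u.degree := by
      rw [← map_add, tsub_add_cancel_of_le hle]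
    omega
  · exact absurd rfl hw

/-- A linear map sending basis vectors to homogeneous vectors of the right degree commutes with
taking components. -/
theorem map_vecComponent {r m : ℕ} (e' : Fin r → ℕ) (e : Fin m → ℕ)
    (f : (Fin r → MvPolynomial σ k) →ₗ[MvPolynomial σ k] (Fin m → MvPolynomial σ k))
    (hf : ∀ b, IsHomogeneousVec e (e' b) (f (Pi.single b 1))) (j : ℕ)
    (w : Fin r → MvPolynomial σ k) : f (vecComponent e' j w) = vecComponent e j (f w) := by
  classical
  induction w using Pi.single_induction with
  | zero => simp [vecComponent_zero]
  | add v w hv hw => simp only [vecComponent_add, map_add, hv, hw]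
  | single b p =>
    induction p using MvPolynomial.induction_on' with
    | add p q hp hq => simp only [Pi.single_add, vecComponent_add, map_add, hp, hq]
    | monomial u a =>
      have hs : (Pi.single b (MvPolynomial.monomial u a) : Fin r → MvPolynomial σ k) =
          MvPolynomial.monomial u a • Pi.single b 1 := by
        rw [← Pi.single_smul, smul_eq_mul, mul_one]
      have h1 : IsHomogeneousVec e' (e' b) (Pi.single b (1 : MvPolynomial σ k)) := by
        intro c v hv
        by_cases hc : c = b
        · subst hc
          rw [Pi.single_eq_same] at hv
          have : v = 0 := by simpa [MvPolynomial.support_one] using hv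
          simp [this]
        · simp [Pi.single_eq_of_ne hc] at hv
      rw [hs, (h1.monomial_smul u a).vecComponent_eq, map_smul,
        ((hf b).monomial_smul u a).vecComponent_eq]
      split_ifs <;> simp

/-- A homogeneous submodule of a graded free module of finite rank has a minimal system of
homogeneous generators. -/
theorem exists_minimal_cover [Finite σ] {m : ℕ} (e : Fin m → ℕ)
    (N : Submodule (MvPolynomial σ k) (Fin m → MvPolynomial σ k))
    (hN : ∀ v ∈ N, ∀ j, vecComponent e j v ∈ N) :
    ∃ (r : ℕ) (e' : Fin r → ℕ)
      (f : (Fin r → MvPolynomial σ k) →ₗ[MvPolynomial σ k] (Fin m → MvPolynomial σ k)),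
      LinearMap.range f = N ∧ (∀ b, IsHomogeneousVec e (e' b) (f (Pi.single b 1))) ∧
      (∀ w ∈ LinearMap.ker f, ∀ b, MvPolynomial.constantCoeff (w b) = 0) ∧
      ∀ w ∈ LinearMap.ker f, ∀ j, vecComponent e' j w ∈ LinearMap.ker f := by
  classical
  let Q : ℕ → Prop := fun r => ∃ (e' : Fin r → ℕ) (g : Fin r → (Fin m → MvPolynomial σ k)),
    Submodule.span (MvPolynomial σ k) (Set.range g) = N ∧ ∀ b, IsHomogeneousVec e (e' b) (g b)
  have hQ : ∃ r, Q r := by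
    let T : Set (Fin m → MvPolynomial σ k) := {v | v ∈ N ∧ ∃ j, IsHomogeneousVec e j v}
    have hT : Submodule.span (MvPolynomial σ k) T = N := by
      apply le_antisymm
      · exact Submodule.span_le.2 fun v hv => hv.1
      · intro v hv
        obtain ⟨J, hJ⟩ := vec_eq_sum_vecComponent e v
        rw [hJ]
        exact Submodule.sum_mem _ fun j _ => Submodule.subset_span
          ⟨hN v hv j, j, isHomogeneousVec_vecComponent e j v⟩
    have hfg : (Submodule.span (MvPolynomial σ k) T).FG := IsNoetherian.noetherian _
    obtain ⟨t, htT, ht⟩ := (Submodule.fg_span_iff_fg_span_finset_subset T).1 hfg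
    choose! dg hdg using fun v (hv : v ∈ T) => hv.2
    refine ⟨t.card, fun b => dg (t.equivFin.symm b), fun b => t.equivFin.symm b, ?_, fun b =>
      hdg _ (htT (t.equivFin.symm b).2)⟩
    have : Set.range (fun b => (t.equivFin.symm b : Fin m → MvPolynomial σ k)) = t := by
      ext v
      constructor
      · rintro ⟨b, rfl⟩
        exact (t.equivFin.symm b).2
      · intro hv
        exact ⟨t.equivFin ⟨v, hv⟩, by simp⟩
    rw [this, ← ht, hT]
  obtain ⟨e', g, hg, hhom⟩ := Nat.find_spec hQ
  have hmin := fun s (hs : s < Nat.find hQ) => Nat.find_min hQ hs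
  generalize Nat.find hQ = r at e' g hg hhom hmin
  let f : (Fin r → MvPolynomial σ k) →ₗ[MvPolynomial σ k] (Fin m → MvPolynomial σ k) :=
    Fintype.linearCombination (MvPolynomial σ k) g
  have hf1 : ∀ b, f (Pi.single b 1) = g b := fun b => by
    simp [f, Fintype.linearCombination_apply_single]
  have hf2 : ∀ b, IsHomogeneousVec e (e' b) (f (Pi.single b 1)) := fun b => by
    rw [hf1]; exact hhom b
  have hker : ∀ w ∈ LinearMap.ker f, ∀ j, vecComponent e' j w ∈ LinearMap.ker f := by
    intro w hw j
    rw [LinearMap.mem_ker] at hw ⊢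
    rw [map_vecComponent e' e f hf2, hw, vecComponent_zero]
  refine ⟨r, e', f, ?_, hf2, ?_, hker⟩
  · rw [← hg]; exact Fintype.range_linearCombination _ _
  · intro w hw b
    by_contra hb
    obtain ⟨s, rfl⟩ : ∃ s, r = s + 1 := ⟨r - 1, by have := b.2; omega⟩
    refine hmin s (Nat.lt_succ_self s) ⟨fun c => e' (b.succAbove c), fun c => g (b.succAbove c),
      ?_, fun c => hhom _⟩
    have hw' := hker w hw (e' b)
    set w' := vecComponent e' (e' b) w with hw'def
    have hwb : w' b = MvPolynomial.C (MvPolynomial.constantCoeff (w b)) := by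
      simp [hw'def, vecComponent, MvPolynomial.homogeneousComponent_zero,
        MvPolynomial.constantCoeff_eq]
    have hsum : w' b • g b + ∑ c, w' (b.succAbove c) • g (b.succAbove c) = 0 := by
      rw [← Fin.sum_univ_succAbove (fun c => w' c • g c) b]
      simpa [f, Fintype.linearCombination_apply] using hw'
    have hgb : g b ∈ Submodule.span (MvPolynomial σ k)
        (Set.range fun c => g (b.succAbove c)) := by
      have h1 : w' b • g b ∈ Submodule.span (MvPolynomial σ k)
          (Set.range fun c => g (b.succAbove c)) := by
        rw [eq_neg_of_add_eq_zero_left hsum]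
        exact Submodule.neg_mem _ (Submodule.sum_mem _ fun c _ => Submodule.smul_mem _ _
          (Submodule.subset_span ⟨c, rfl⟩))
      have h2 := Submodule.smul_mem _
        (MvPolynomial.C (MvPolynomial.constantCoeff (w b))⁻¹ : MvPolynomial σ k) h1
      rwa [hwb, smul_smul, ← map_mul, inv_mul_cancel₀ hb, map_one, one_smul] at h2
    rw [← hg]
    apply le_antisymm
    · apply Submodule.span_mono
      rintro _ ⟨c, rfl⟩
      exact ⟨_, rfl⟩
    · rw [Submodule.span_le]
      rintro _ ⟨c, rfl⟩
      rcases Fin.eq_self_or_eq_succAbove b c with rfl | ⟨c', rfl⟩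
      · exact hgb
      · exact Submodule.subset_span ⟨c', rfl⟩

/-- Every homogeneous ideal of a polynomial ring in finitely many variables has a minimal graded
free resolution. -/
theorem nonempty_minimalGradedFreeResolution [Finite σ] (I : Ideal (MvPolynomial σ k))
    (hI : ∀ p ∈ I, ∀ j, MvPolynomial.homogeneousComponent j p ∈ I) :
    Nonempty (MinimalGradedFreeResolution I) := by
  classical
  let E := LinearEquiv.funUnique (Fin 1) (MvPolynomial σ k) (MvPolynomial σ k)
  obtain ⟨r₀, e₀, f₀, hr₀, hh₀, hc₀, hk₀⟩ := exists_minimal_cover (fun _ : Fin 1 => 0)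
    (Submodule.comap E.toLinearMap I) (fun v hv j => by simpa [E, vecComponent] using hI _ hv j)
  let St := Σ' (m : ℕ) (e : Fin m → ℕ),
    {N : Submodule (MvPolynomial σ k) (Fin m → MvPolynomial σ k) //
      (∀ v ∈ N, ∀ j, vecComponent e j v ∈ N) ∧
      ∀ v ∈ N, ∀ b, MvPolynomial.constantCoeff (v b) = 0}
  choose nr ne nf hnr hnh hnc hnk using fun s : St => exists_minimal_cover s.2.1 s.2.2.1 s.2.2.2.1
  let st : ℕ → St := fun i => Nat.rec ⟨r₀, e₀, LinearMap.ker f₀, hk₀, hc₀⟩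
    (fun _ s => ⟨nr s, ne s, LinearMap.ker (nf s), hnk s, hnc s⟩) i
  refine ⟨{
    rank := fun i => (st i).1
    deg := fun i => (st i).2.1
    aug := E.toLinearMap ∘ₗ f₀
    d := fun i => nf (st i)
    range_aug := ?_
    exact_zero := ?_
    exact_succ := fun i => hnr (st (i + 1))
    aug_homogeneous := ?_
    d_homogeneous := fun i b => hnh (st i) b
    minimal := fun i b c => (st i).2.2.2.2 _ (by rw [← hnr (st i)]; exact ⟨_, rfl⟩) c }⟩
  · rw [LinearMap.range_comp, hr₀, Submodule.map_comap_eq_of_surjective E.surjective]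
  · rw [hnr (st 0)]
    ext w
    simp [st]
  · intro b u hu
    have := hh₀ b 0 u (MvPolynomial.mem_support_iff.2 hu)
    rw [← MvPolynomial.mem_support_iff] at hu
    rw [Finsupp.degree_eq_weight_one, add_zero] at this
    exact this

end Existence

open Classical in
/-- The graded Betti number `β_{i,j}(I)`: the number of summands `S(-j)` in the `i`-th term of a
minimal graded free resolution of the homogeneous ideal `I`. It does not depend on the resolution,
and it is `0` for `i < 0`. -/
noncomputable def gradedBetti {k : Type*} [Field k] {σ : Type*} (I : Ideal (MvPolynomial σ k))
    (i j : ℤ) : ℕ :=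
  if h : Nonempty (MinimalGradedFreeResolution I) then
    if 0 ≤ i then Nat.card {b : Fin (h.some.rank i.toNat) // (h.some.deg i.toNat b : ℤ) = j}
    else 0
  else 0

/-! Index `[n]` from `0`, put `x = X (0, a)`, and let `I` and `J` be the extensions to the big
polynomial ring of `L(n, P ∖ {a})` and of `L(n-1, P)`, the latter in the variables of first index `≥
1`. A multichain either starts at `a` or avoids `a`, so `L(n, P) = I + xJ`
(`letterplaceIdeal_succ`). Moreover `I ⊆ J`, and `x` is regular modulo `I` because it does not occur
in the generators of `I`. Hence `I ∩ xJ = xI`, and there is an exact sequence `0 → I(-1) → I ⊕ J(-1)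
→ I + xJ → 0`. The mapping cone of `(x, -φ)`, with `φ` lifting `I ⊆ J` to resolutions, resolves `I +
xJ`; its ranks are the three terms of the formula (`ConeData.cone`).

What remains is minimality of the cone, that is, `φ` without constant terms. Each generator of `I`
is some `X (0, p)` times a generator of `J`, so `I ⊆ 𝔞J` with `𝔞` generated by the variables `X (0,
p)`. The resolution of `J` does not involve these variables, so its subcomplex with coefficients in
`𝔞` stays exact and `φ` can be built with entries in `𝔞` (`exists_comparison`, `exists_coneData`).

Betti numbers can be read off any minimal resolution (`card_le`) and do not change when variables
are added (`baseChange`). Resolutions start at `F₀ = S`, and the map `F₁ → S` may contain units,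
since `L(0, P)` is the unit ideal. -/

section GradedMatrix

/-! ### Graded matrices over a polynomial ring -/

open Matrix MvPolynomial

variable {k : Type*} [Field k] {σ : Type*}

/-- The degree `j` component of an element of `S(-e)`. -/
noncomputable def shiftedComponent (e j : ℕ) : MvPolynomial σ k →ₗ[k] MvPolynomial σ k :=
  if e ≤ j then homogeneousComponent (j - e) else 0

theorem coeff_shiftedComponent (e j : ℕ) (p : MvPolynomial σ k) (u : σ →₀ ℕ) :
    (shiftedComponent e j p).coeff u = if u.degree + e = j then p.coeff u else 0 := by
  unfold shiftedComponent
  split_ifs with h1 h2 h2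
  · rw [coeff_homogeneousComponent, if_pos (by omega)]
  · rw [coeff_homogeneousComponent, if_neg (by omega)]
  · omega
  · simp

theorem shiftedComponent_eq_self_iff {e j : ℕ} {p : MvPolynomial σ k} :
    shiftedComponent e j p = p ↔ ∀ u ∈ p.support, u.degree + e = j := by
  constructor
  · intro h u hu
    rw [mem_support_iff, ← h, coeff_shiftedComponent] at hu
    by_contra h'
    exact hu (if_neg h')
  · intro h
    ext u
    rw [coeff_shiftedComponent]
    by_cases hu : u ∈ p.support
    · rw [if_pos (h u hu)]
    · rw [notMem_support_iff.1 hu, ite_self]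

theorem shiftedComponent_idem (e j : ℕ) (p : MvPolynomial σ k) :
    shiftedComponent e j (shiftedComponent e j p) = shiftedComponent e j p := by
  ext u
  simp only [coeff_shiftedComponent]
  split_ifs <;> rfl

/-- Multiplication by such a `p` is a degree-preserving map `S(-e') → S(-e)`, so it commutes with
taking components. -/
theorem mul_shiftedComponent {e e' : ℕ} {p : MvPolynomial σ k}
    (hp : ∀ u ∈ p.support, u.degree + e = e') (j : ℕ) (q : MvPolynomial σ k) :
    p * shiftedComponent e' j q = shiftedComponent e j (p * q) := by
  classical
  ext u
  rw [coeff_shiftedComponent, coeff_mul, coeff_mul,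
    show ∀ (q : Prop) [Decidable q] (t : k), (if q then t else 0) = t * if q then 1 else 0 by simp,
    Finset.sum_mul]
  refine Finset.sum_congr rfl fun x hx => ?_
  rw [coeff_shiftedComponent]
  by_cases hx1 : x.1 ∈ p.support
  · have h1 := hp _ hx1
    have h2 : x.1.degree + x.2.degree = u.degree := by
      rw [← map_add, Finset.HasAntidiagonal.mem_antidiagonal.1 hx]
    by_cases h : u.degree + e = j
    · rw [if_pos h, if_pos (by omega), mul_one]
    · rw [if_neg h, if_neg (by omega), mul_zero, mul_zero]
  · rw [notMem_support_iff.1 hx1]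
    simp

/-- `M` is the matrix of a degree preserving map `⨁_b S(-e' b) → ⨁_c S(-e c)`. -/
def IsGradedMatrix {κ ι : Type*} (e : κ → ℕ) (e' : ι → ℕ) (M : Matrix κ ι (MvPolynomial σ k)) :
    Prop :=
  ∀ c b, ∀ u ∈ (M c b).support, u.degree + e c = e' b

theorem IsGradedMatrix.mulVec_shiftedComponent {κ ι : Type*} [Fintype ι] {e : κ → ℕ} {e' : ι → ℕ}
    {M : Matrix κ ι (MvPolynomial σ k)} (hM : IsGradedMatrix e e' M) (j : ℕ)
    (w : ι → MvPolynomial σ k) :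
    (M *ᵥ fun b => shiftedComponent (e' b) j (w b)) =
      fun c => shiftedComponent (e c) j ((M *ᵥ w) c) := by
  ext1 c
  simp only [mulVec, dotProduct, map_sum]
  exact Finset.sum_congr rfl fun b _ => mul_shiftedComponent (hM c b) j (w b)

theorem IsGradedMatrix.mul {κ ι l : Type*} [Fintype ι] {e : κ → ℕ} {e' : ι → ℕ} {e'' : l → ℕ}
    {M : Matrix κ ι (MvPolynomial σ k)} {N : Matrix ι l (MvPolynomial σ k)}
    (hM : IsGradedMatrix e e' M) (hN : IsGradedMatrix e' e'' N) :
    IsGradedMatrix e e'' (M * N) := by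
  intro c a
  rw [← shiftedComponent_eq_self_iff, Matrix.mul_apply, map_sum]
  refine Finset.sum_congr rfl fun b _ => ?_
  rw [← mul_shiftedComponent (hM c b), shiftedComponent_eq_self_iff.2 (hN b a)]

/-- Homogeneous vectors that lift through a graded matrix with entries in a homogeneous ideal
lift to a graded matrix with entries in that ideal. -/
theorem IsGradedMatrix.exists_lift {κ κ' ι : Type*} [Fintype κ'] {e : κ → ℕ} {e' : κ' → ℕ}
    {f : ι → ℕ} {D : Matrix κ κ' (MvPolynomial σ k)} (hD : IsGradedMatrix e e' D)
    {F : Matrix κ ι (MvPolynomial σ k)} (hF : IsGradedMatrix e f F)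
    {𝔞 : Ideal (MvPolynomial σ k)} (h𝔞 : ∀ p ∈ 𝔞, ∀ i j, shiftedComponent i j p ∈ 𝔞)
    (h : ∀ b, ∃ w : κ' → MvPolynomial σ k, (∀ c, w c ∈ 𝔞) ∧ D *ᵥ w = fun c => F c b) :
    ∃ Φ : Matrix κ' ι (MvPolynomial σ k),
      IsGradedMatrix e' f Φ ∧ (∀ c b, Φ c b ∈ 𝔞) ∧ D * Φ = F := by
  choose w hw𝔞 hw using h
  -- The degree `f b` part of an arbitrary lift of column `b` is still a lift, since that column is
  -- homogeneous of degree `f b`.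
  refine ⟨fun c b => shiftedComponent (e' c) (f b) (w b c), fun c b => ?_,
    fun c b => h𝔞 _ (hw𝔞 b c) _ _, ?_⟩
  · rw [← shiftedComponent_eq_self_iff, shiftedComponent_idem]
  · ext1 c b
    have := congrFun (hD.mulVec_shiftedComponent (f b) (w b)) c
    rw [hw, shiftedComponent_eq_self_iff.2 (hF c b)] at this
    exact this

end GradedMatrix

/-! ### Comparison maps and uniqueness of minimal resolutions -/

section Resolution

open Matrix MvPolynomial

/-- A graded free resolution `⋯ → F₂ → F₁ → F₀ = S` of `S ⧸ I`, given by matrices, whose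
differentials `F_{i+2} → F_{i+1}` are minimal. -/
structure MatrixResolution {k : Type*} [Field k] {σ : Type*} (I : Ideal (MvPolynomial σ k)) where
  /-- the basis of `F_i` -/
  ι : ℕ → Type
  [fintype : ∀ i, Fintype (ι i)]
  [unique : Unique (ι 0)]
  /-- the degrees of the basis elements of `F_i` -/
  deg : ∀ i, ι i → ℕ
  /-- the differential `F_{i+1} → F_i` -/
  d : ∀ i, Matrix (ι i) (ι (i + 1)) (MvPolynomial σ k)
  deg_zero : ∀ b, deg 0 b = 0
  span_range : Ideal.span (Set.range (d 0 default)) = I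
  graded : ∀ i, IsGradedMatrix (deg i) (deg (i + 1)) (d i)
  d_mul_d : ∀ i, d i * d (i + 1) = 0
  exact : ∀ i v, d i *ᵥ v = 0 → ∃ w, d (i + 1) *ᵥ w = v
  minimal : ∀ i b c, constantCoeff (d (i + 1) b c) = 0

attribute [instance] MatrixResolution.fintype MatrixResolution.unique

namespace MatrixResolution

variable {k : Type*} [Field k] {σ : Type*} {I J : Ideal (MvPolynomial σ k)}

theorem d_zero_mem (R : MatrixResolution I) (c : R.ι 0) (b : R.ι 1) : R.d 0 c b ∈ I := by
  rw [Unique.eq_default c]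
  exact R.span_range.le (Ideal.subset_span ⟨b, rfl⟩)

theorem mem_iff (R : MatrixResolution I) {p : MvPolynomial σ k} :
    p ∈ I ↔ ∃ w : R.ι 1 → MvPolynomial σ k, R.d 0 *ᵥ w = fun _ => p := by
  refine (SetLike.ext_iff.1 R.span_range p).symm.trans ?_
  rw [Ideal.mem_span_range_iff_exists_fun]
  refine exists_congr fun w => ?_
  rw [funext_iff, Unique.forall_iff]
  simp only [mulVec, dotProduct, mul_comm]

/-- The comparison map over the inclusion of ideals `I ⊆ J`, with entries in an ideal `𝔞` such
that the subcomplex `𝔞 T` is exact. -/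
theorem exists_comparison (R : MatrixResolution I) (T : MatrixResolution J)
    {𝔞 : Ideal (MvPolynomial σ k)} (h𝔞 : ∀ p ∈ 𝔞, ∀ i j, shiftedComponent i j p ∈ 𝔞)
    (hIJ : ∀ p ∈ I, ∃ w : T.ι 1 → MvPolynomial σ k, (∀ c, w c ∈ 𝔞) ∧ T.d 0 *ᵥ w = fun _ => p)
    (hT : ∀ i, ∀ v : T.ι (i + 1) → MvPolynomial σ k, (∀ c, v c ∈ 𝔞) → T.d i *ᵥ v = 0 →
      ∃ w : T.ι (i + 2) → MvPolynomial σ k, (∀ c, w c ∈ 𝔞) ∧ T.d (i + 1) *ᵥ w = v) :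
    ∃ φ : ∀ i, Matrix (T.ι i) (R.ι i) (MvPolynomial σ k), φ 0 = Matrix.of (fun _ _ => 1) ∧
      (∀ i, IsGradedMatrix (T.deg i) (R.deg i) (φ i)) ∧ (∀ i c b, φ (i + 1) c b ∈ 𝔞) ∧
      ∀ i, T.d i * φ (i + 1) = φ i * R.d i := by
  -- The recursion carries liftability of `φ d` with coefficients in `𝔞`, not membership of `φ` in
  -- `𝔞`: the initial `φ 0 = 1` need not have entries in `𝔞`.
  let Good : ∀ i, Matrix (T.ι i) (R.ι i) (MvPolynomial σ k) → Prop := fun i φ =>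
    IsGradedMatrix (T.deg i) (R.deg i) φ ∧ ∀ b, ∃ w : T.ι (i + 1) → MvPolynomial σ k,
      (∀ c, w c ∈ 𝔞) ∧ T.d i *ᵥ w = fun c => (φ * R.d i) c b
  have step : ∀ i (φ : {φ // Good i φ}), ∃ ψ : {ψ // Good (i + 1) ψ},
      (∀ c b, ψ.1 c b ∈ 𝔞) ∧ T.d i * ψ.1 = φ.1 * R.d i := by
    rintro i ⟨φ, hφ, hφ'⟩
    obtain ⟨ψ, h1, h2, h3⟩ := (T.graded i).exists_lift (hφ.mul (R.graded i)) h𝔞 hφ'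
    refine ⟨⟨ψ, h1, fun b => ?_⟩, h2, h3⟩
    refine hT i _ (fun c => ?_) ?_
    · rw [Matrix.mul_apply]
      exact Ideal.sum_mem _ fun a _ => Ideal.mul_mem_right _ _ (h2 c a)
    · ext1 c
      change (T.d i * (ψ * R.d (i + 1))) c b = 0
      rw [← Matrix.mul_assoc, h3, Matrix.mul_assoc, R.d_mul_d, Matrix.mul_zero, Matrix.zero_apply]
  choose next hnext𝔞 hnext using step
  have h0 : Good 0 (Matrix.of fun _ _ => 1) := by
    refine ⟨fun c b u hu => ?_, fun b => ?_⟩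
    · have : u = 0 := by simpa [support_one] using hu
      simp [this, T.deg_zero, R.deg_zero]
    · obtain ⟨w, h1, h2⟩ := hIJ _ (R.d_zero_mem default b)
      refine ⟨w, h1, ?_⟩
      rw [h2]
      ext1 c
      simp [Matrix.mul_apply, Subsingleton.elim c default]
  let φ : ∀ i, {φ // Good i φ} := fun i => Nat.rec ⟨_, h0⟩ next i
  exact ⟨fun i => (φ i).1, rfl, fun i => (φ i).2.1, fun i => hnext𝔞 i (φ i),
    fun i => hnext i (φ i)⟩

theorem exists_comparison_of_le (R : MatrixResolution I) (T : MatrixResolution J) (h : I ≤ J) :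
    ∃ φ : ∀ i, Matrix (T.ι i) (R.ι i) (MvPolynomial σ k), φ 0 = Matrix.of (fun _ _ => 1) ∧
      (∀ i, IsGradedMatrix (T.deg i) (R.deg i) (φ i)) ∧
      ∀ i, T.d i * φ (i + 1) = φ i * R.d i := by
  obtain ⟨φ, h1, h2, -, h3⟩ := R.exists_comparison T (𝔞 := ⊤) (fun _ _ _ _ => trivial)
    (fun p hp => (T.mem_iff.1 (h hp)).imp fun w hw => ⟨fun _ => trivial, hw⟩)
    (fun i v _ hv => (T.exact i v hv).imp fun w hw => ⟨fun _ => trivial, hw⟩)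
  exact ⟨φ, h1, h2, h3⟩

/-- An endomorphism of a minimal resolution which vanishes on `F₀` vanishes modulo the variables. -/
theorem map_constantCoeff_eq_zero (R : MatrixResolution I)
    (f : ∀ i, Matrix (R.ι i) (R.ι i) (MvPolynomial σ k)) (h0 : f 0 = 0)
    (hf : ∀ i, R.d i * f (i + 1) = f i * R.d i) (i : ℕ) : (f i).map constantCoeff = 0 := by
  classical
  -- Here `h` is one stage of a null-homotopy: `f (i + 1) - h d` maps into the kernel of `d i`, and
  -- lifting it through `d (i + 1)` gives the next stage. Starting at `h = 0` makes `h d` vanish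
  -- modulo the variables even if `d 0` contains units.
  have key : ∀ i, ∃ h : Matrix (R.ι (i + 1)) (R.ι i) (MvPolynomial σ k),
      R.d i * (h * R.d i) = R.d i * f (i + 1) ∧ (h * R.d i).map constantCoeff = 0 ∧
      (f i).map constantCoeff = 0 := by
    intro i
    induction i with
    | zero => exact ⟨0, by simp [hf, h0], by simp, by simp [h0]⟩
    | succ i ih =>
      obtain ⟨h, h1, h2, -⟩ := ih
      have h3 : ∀ b, ∃ w : R.ι (i + 2) → MvPolynomial σ k,
          R.d (i + 1) *ᵥ w = fun c => (f (i + 1) - h * R.d i) c b := by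
        refine fun b => R.exact i _ ?_
        ext1 c
        change (R.d i * (f (i + 1) - h * R.d i)) c b = 0
        rw [Matrix.mul_sub, h1, sub_self, Matrix.zero_apply]
      choose w hw using h3
      have h4 : R.d (i + 1) * Matrix.of (fun c b => w b c) = f (i + 1) - h * R.d i := by
        ext1 c b
        exact congrFun (hw b) c
      have h5 : (R.d (i + 1)).map constantCoeff = 0 := by
        ext1 b c
        exact R.minimal i b c
      refine ⟨Matrix.of (fun c b => w b c), ?_, ?_, ?_⟩
      · rw [← Matrix.mul_assoc, h4, Matrix.sub_mul, Matrix.mul_assoc h, R.d_mul_d, Matrix.mul_zero,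
          sub_zero, hf (i + 1)]
      · rw [Matrix.map_mul, h5, Matrix.mul_zero]
      · rw [eq_sub_iff_add_eq] at h4
        rw [← h4, Matrix.map_add _ (map_add _), h2, Matrix.map_mul, h5, Matrix.zero_mul, add_zero]
  exact (key i).choose_spec.2.2

/-- Comparison maps `φ`, `ψ` in both directions compose to an endomorphism that is the identity on
`F₀`, so `ψ φ = 1` modulo the variables. Constant entries link only basis elements of equal degree,
so this identity restricts to degree `j` and bounds the rank. -/
theorem card_le (R T : MatrixResolution I) (i j : ℕ) :
    Nat.card {b // R.deg i b = j} ≤ Nat.card {b // T.deg i b = j} := by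
  classical
  obtain ⟨φ, hφ0, hφ, hφd⟩ := R.exists_comparison_of_le T le_rfl
  obtain ⟨ψ, hψ0, hψ, hψd⟩ := T.exists_comparison_of_le R le_rfl
  have h1 : (ψ i * φ i - 1).map constantCoeff = 0 := by
    refine R.map_constantCoeff_eq_zero (fun i => ψ i * φ i - 1) ?_ (fun i => ?_) i
    · ext1 b c
      simp [hφ0, hψ0, Matrix.mul_apply, Subsingleton.elim b c]
    · rw [Matrix.mul_sub, Matrix.sub_mul, ← Matrix.mul_assoc, hψd, Matrix.mul_assoc, hφd,
        Matrix.mul_assoc, Matrix.mul_one, Matrix.one_mul]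
  have h2 : (ψ i).map constantCoeff * (φ i).map constantCoeff = 1 := by
    rw [Matrix.map_sub _ (map_sub _), sub_eq_zero, Matrix.map_mul] at h1
    rw [h1, Matrix.map_one _ (map_zero _) (map_one _)]
  let A : Matrix {b // R.deg i b = j} {b // T.deg i b = j} k :=
    ((ψ i).map constantCoeff).submatrix Subtype.val Subtype.val
  let B : Matrix {b // T.deg i b = j} {b // R.deg i b = j} k :=
    ((φ i).map constantCoeff).submatrix Subtype.val Subtype.val
  have h3 : A * B = 1 := by
    ext1 b c
    have h4 := congrFun (congrFun h2 b.1) c.1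
    rw [Matrix.mul_apply, ← Finset.sum_subset (Finset.subset_univ {a | T.deg i a = j})] at h4
    · rw [Matrix.mul_apply]
      refine ((Finset.sum_subtype _ (p := fun a => T.deg i a = j) (by simp) fun a =>
        (ψ i).map constantCoeff b.1 a * (φ i).map constantCoeff a c.1).symm.trans h4).trans ?_
      simp [Matrix.one_apply, Subtype.ext_iff]
    · intro a _ ha
      suffices h : constantCoeff (ψ i b.1 a) = 0 by simp [h]
      rw [constantCoeff_eq, ← notMem_support_iff]
      intro h
      have := hψ i _ _ _ h
      rw [b.2, map_zero, zero_add] at this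
      exact ha (by simp [this])
  have h5 := (Matrix.rank_mul_le_left A B).trans A.rank_le_card_width
  rwa [h3, Matrix.rank_one, ← Nat.card_eq_fintype_card, ← Nat.card_eq_fintype_card] at h5

end MatrixResolution
end Resolution
-- Adding variables to a resolution
section BaseChange

open Matrix MvPolynomial

theorem coeff_map_C_mulVec {A τ κ ι : Type*} [CommRing A] [Fintype ι] (M : Matrix κ ι A)
    (w : ι → MvPolynomial τ A) (u : τ →₀ ℕ) (b : κ) :
    ((M.map C *ᵥ w) b).coeff u = (M *ᵥ fun c => (w c).coeff u) b := by
  simp [mulVec, dotProduct, coeff_sum, coeff_C_mul]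

/-- Flatness of `A → A[τ]`: a linear system with coefficients in `A` splits into one system over `A`
for each monomial. -/
theorem exists_map_C_mulVec_eq {A τ κ ι ι' : Type*} [CommRing A] [Fintype ι] [Fintype ι']
    {M : Matrix κ ι A} {N : Matrix ι ι' A} (h : ∀ v, M *ᵥ v = 0 → ∃ w, N *ᵥ w = v)
    (v : ι → MvPolynomial τ A) (hv : M.map C *ᵥ v = 0) :
    ∃ w : ι' → MvPolynomial τ A, N.map C *ᵥ w = v := by
  classical
  have h1 : ∀ u : τ →₀ ℕ, ∃ w : ι' → A, N *ᵥ w = fun b => (v b).coeff u := by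
    refine fun u => h _ ?_
    ext1 b
    rw [← coeff_map_C_mulVec, hv]
    simp
  choose w hw using h1
  -- Only monomials of `v` enter: the chosen `w u` need not vanish for the others.
  refine ⟨fun c => ∑ u ∈ Finset.univ.biUnion fun b => (v b).support, monomial u (w u c), ?_⟩
  ext b u
  rw [coeff_map_C_mulVec]
  by_cases hu : u ∈ Finset.univ.biUnion fun b => (v b).support
  · simpa only [coeff_sum, coeff_monomial, Finset.sum_ite_eq', if_pos hu] using congrFun (hw u) b
  · simp only [coeff_sum, coeff_monomial, Finset.sum_ite_eq', if_neg hu]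
    rw [Finset.mem_biUnion, not_exists] at hu
    have hb : u ∉ (v b).support := fun h => hu b ⟨Finset.mem_univ b, h⟩
    rw [notMem_support_iff.1 hb]
    simp [mulVec, dotProduct]

variable {k : Type*} [Field k] {σ τ : Type*}

/-- The variables outside the range of `f` become polynomial variables over `k[τ]`, which turns
renamed matrices into constant ones. -/
theorem exists_ringEquiv_rename {f : τ → σ} (hf : Function.Injective f) :
    ∃ E : MvPolynomial σ k ≃+* MvPolynomial ((Set.range f)ᶜ : Set σ) (MvPolynomial τ k),
      ∀ p, E (rename f p) = C p := by
  let e : ((Set.range f)ᶜ : Set σ) ⊕ τ ≃ σ := Equiv.ofBijective (Sum.elim Subtype.val f) (by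
    constructor
    · exact Subtype.val_injective.sumElim hf fun a b h => a.2 ⟨b, h.symm⟩
    · intro s
      by_cases hs : s ∈ Set.range f
      · obtain ⟨t, rfl⟩ := hs
        exact ⟨Sum.inr t, rfl⟩
      · exact ⟨Sum.inl ⟨s, hs⟩, rfl⟩)
  refine ⟨((renameEquiv k e.symm).trans (sumAlgEquiv k _ _)).toRingEquiv, fun p => ?_⟩
  have h1 : rename e.symm (rename f p) = rename Sum.inr p := by
    rw [rename_rename]
    congr 2
    ext1 t
    exact e.symm_apply_apply (Sum.inr t)
  have h2 := DFunLike.congr_fun (sumAlgEquiv_comp_rename_inr k ((Set.range f)ᶜ : Set σ) τ) p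
  change sumAlgEquiv k _ _ (rename e.symm (rename f p)) = C p
  rw [h1]
  exact h2

theorem exists_map_rename_mulVec_eq {κ ι ι' : Type*} [Fintype ι] [Fintype ι']
    {f : τ → σ} (hf : Function.Injective f)
    {M : Matrix κ ι (MvPolynomial τ k)} {N : Matrix ι ι' (MvPolynomial τ k)}
    (h : ∀ v, M *ᵥ v = 0 → ∃ w, N *ᵥ w = v)
    (v : ι → MvPolynomial σ k) (hv : M.map (rename f) *ᵥ v = 0) :
    ∃ w : ι' → MvPolynomial σ k, N.map (rename f) *ᵥ w = v := by
  obtain ⟨E, hE⟩ := exists_ringEquiv_rename (k := k) hf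
  obtain ⟨w, hw⟩ := exists_map_C_mulVec_eq h (fun b => E (v b)) (by
    ext1 b
    have := congrArg E (congrFun hv b)
    simpa [mulVec, dotProduct, hE] using this)
  refine ⟨fun c => E.symm (w c), ?_⟩
  ext1 b
  apply E.injective
  simpa [mulVec, dotProduct, hE] using congrFun hw b

theorem IsGradedMatrix.map_rename {κ ι : Type*} {e : κ → ℕ} {e' : ι → ℕ}
    {M : Matrix κ ι (MvPolynomial τ k)} (hM : IsGradedMatrix e e' M) {f : τ → σ}
    (hf : Function.Injective f) : IsGradedMatrix e e' (M.map (rename f)) := by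
  classical
  intro c b u hu
  rw [Matrix.map_apply, support_rename_of_injective hf, Finset.mem_image] at hu
  obtain ⟨u, hu, rfl⟩ := hu
  rw [Finsupp.degree_mapDomain, hM c b u hu]

namespace MatrixResolution

variable {I : Ideal (MvPolynomial τ k)}

/-- Extension of a resolution to a polynomial ring in more variables. -/
noncomputable def baseChange (R : MatrixResolution I) {f : τ → σ} (hf : Function.Injective f) :
    MatrixResolution (I.map (rename f : MvPolynomial τ k →ₐ[k] MvPolynomial σ k)) where
  ι := R.ι
  deg := R.deg
  d i := (R.d i).map (rename f)
  deg_zero := R.deg_zero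
  span_range := by
    conv_rhs => rw [← R.span_range]
    rw [Ideal.map_span, ← Set.range_comp]
    rfl
  graded i := (R.graded i).map_rename hf
  d_mul_d i := by
    have := congrArg (fun M => M.map (rename f : MvPolynomial τ k →ₐ[k] MvPolynomial σ k))
      (R.d_mul_d i)
    simpa only [Matrix.map_mul, Matrix.map_zero _ (map_zero _)] using this
  exact i := exists_map_rename_mulVec_eq hf (R.exact i)
  minimal i b c := by
    rw [Matrix.map_apply, constantCoeff_rename, R.minimal]

end MatrixResolution

end BaseChange

/-! ### Betti numbers from matrix resolutions -/

section Betti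

open Matrix MvPolynomial

namespace MinimalGradedFreeResolution

variable {k : Type*} [Field k] {σ : Type*} {I : Ideal (MvPolynomial σ k)}
  (F : MinimalGradedFreeResolution I)

/-- The matrix of the map `F₀ → S`. -/
noncomputable def augMatrix : Matrix Unit (Fin (F.rank 0)) (MvPolynomial σ k) :=
  LinearMap.toMatrix' (LinearMap.pi fun _ => F.aug)

/-- The matrix of the differential `F_{i+1} → F_i`. -/
noncomputable def dMatrix (i : ℕ) :
    Matrix (Fin (F.rank i)) (Fin (F.rank (i + 1))) (MvPolynomial σ k) :=
  LinearMap.toMatrix' (F.d i)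

theorem augMatrix_mulVec (w : Fin (F.rank 0) → MvPolynomial σ k) :
    F.augMatrix *ᵥ w = fun _ => F.aug w :=
  LinearMap.toMatrix'_mulVec _ _

theorem dMatrix_mulVec (i : ℕ) (w : Fin (F.rank (i + 1)) → MvPolynomial σ k) :
    F.dMatrix i *ᵥ w = F.d i w :=
  LinearMap.toMatrix'_mulVec _ _

theorem augMatrix_apply (c : Unit) (b : Fin (F.rank 0)) :
    F.augMatrix c b = F.aug (Pi.single b 1) :=
  LinearMap.toMatrix'_apply _ _ _

theorem dMatrix_apply (i : ℕ) (c : Fin (F.rank i)) (b : Fin (F.rank (i + 1))) :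
    F.dMatrix i c b = F.d i (Pi.single b 1) c :=
  LinearMap.toMatrix'_apply _ _ _

theorem span_range_augMatrix : Ideal.span (Set.range (F.augMatrix ())) = I := by
  ext p
  rw [Ideal.mem_span_range_iff_exists_fun, ← SetLike.ext_iff.1 F.range_aug p, LinearMap.mem_range]
  refine exists_congr fun w => ?_
  rw [← congrFun (F.augMatrix_mulVec w) ()]
  simp only [mulVec, dotProduct, mul_comm]

theorem isGradedMatrix_augMatrix : IsGradedMatrix (fun _ => 0) (F.deg 0) F.augMatrix := by
  intro c b u hu
  rw [augMatrix_apply] at hu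
  rw [add_zero, Finsupp.degree_eq_weight_one]
  exact F.aug_homogeneous b (mem_support_iff.1 hu)

theorem isGradedMatrix_dMatrix (i : ℕ) : IsGradedMatrix (F.deg i) (F.deg (i + 1)) (F.dMatrix i) := by
  intro c b u hu
  rw [dMatrix_apply] at hu
  exact F.d_homogeneous i b c u hu

theorem augMatrix_mulVec_eq_zero_iff {v : Fin (F.rank 0) → MvPolynomial σ k} :
    F.augMatrix *ᵥ v = 0 ↔ ∃ w, F.dMatrix 0 *ᵥ w = v := by
  simp_rw [dMatrix_mulVec]
  rw [augMatrix_mulVec, ← LinearMap.mem_range, F.exact_zero, LinearMap.mem_ker, funext_iff]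
  exact ⟨fun h => h (), fun h _ => h⟩

theorem dMatrix_mulVec_eq_zero_iff (i : ℕ) {v : Fin (F.rank (i + 1)) → MvPolynomial σ k} :
    F.dMatrix i *ᵥ v = 0 ↔ ∃ w, F.dMatrix (i + 1) *ᵥ w = v := by
  simp_rw [dMatrix_mulVec]
  rw [← LinearMap.mem_range, F.exact_succ, LinearMap.mem_ker]

end MinimalGradedFreeResolution

theorem Matrix.mul_eq_zero_of_mulVec {R l m n : Type*} [CommRing R] [Fintype m] [Fintype n]
    {M : Matrix l m R} {N : Matrix m n R} (h : ∀ v, M *ᵥ (N *ᵥ v) = 0) : M * N = 0 := by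
  classical
  refine Matrix.ext_of_mulVec_single fun i => ?_
  rw [← mulVec_mulVec, h, zero_mulVec]

namespace MatrixResolution

variable {k : Type*} [Field k] {σ : Type*} {I : Ideal (MvPolynomial σ k)}

/-- The matrices of a minimal graded free resolution. -/
noncomputable def ofMinimalGradedFreeResolution (F : MinimalGradedFreeResolution I) :
    MatrixResolution I where
  ι := fun | 0 => Unit | i + 1 => Fin (F.rank i)
  fintype := fun | 0 => inferInstanceAs (Fintype Unit)
                 | i + 1 => inferInstanceAs (Fintype (Fin (F.rank i)))
  unique := inferInstanceAs (Unique Unit)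
  deg := fun | 0 => fun _ => 0 | i + 1 => F.deg i
  d := fun | 0 => F.augMatrix | i + 1 => F.dMatrix i
  deg_zero _ := rfl
  span_range := F.span_range_augMatrix
  graded
    | 0 => F.isGradedMatrix_augMatrix
    | i + 1 => F.isGradedMatrix_dMatrix i
  d_mul_d
    | 0 => mul_eq_zero_of_mulVec fun v => F.augMatrix_mulVec_eq_zero_iff.2 ⟨v, rfl⟩
    | i + 1 => mul_eq_zero_of_mulVec fun v => (F.dMatrix_mulVec_eq_zero_iff i).2 ⟨v, rfl⟩
  exact
    | 0 => fun _ => F.augMatrix_mulVec_eq_zero_iff.1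
    | i + 1 => fun _ => (F.dMatrix_mulVec_eq_zero_iff i).1
  minimal i b c := (congrArg constantCoeff (F.dMatrix_apply i b c)).trans (F.minimal i c b)

theorem homogeneousComponent_mem (R : MatrixResolution I) {p : MvPolynomial σ k} (hp : p ∈ I)
    (j : ℕ) : homogeneousComponent j p ∈ I := by
  obtain ⟨w, hw⟩ := R.mem_iff.1 hp
  refine R.mem_iff.2 ⟨_, ((R.graded 0).mulVec_shiftedComponent j w).trans ?_⟩
  ext1 c
  rw [hw, R.deg_zero]
  simp [shiftedComponent]

/-- The index `i + 1` appears because `R` resolves `S ⧸ I` and `ι 0` is the basis of `S`. The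
existence of `R` makes `I` homogeneous, so the resolution chosen in `gradedBetti` exists; `card_le`
is then applied both ways. -/
theorem gradedBetti_eq [Finite σ] (R : MatrixResolution I) (i j : ℕ) :
    gradedBetti I i j = Nat.card {b // R.deg (i + 1) b = j} := by
  have h : Nonempty (MinimalGradedFreeResolution I) :=
    nonempty_minimalGradedFreeResolution I fun p hp j => R.homogeneousComponent_mem hp j
  rw [gradedBetti, dif_pos h, if_pos (Int.natCast_nonneg i), Int.toNat_natCast]
  simp only [Nat.cast_inj]
  exact ((ofMinimalGradedFreeResolution h.some).card_le R (i + 1) j).antisymm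
    (R.card_le (ofMinimalGradedFreeResolution h.some) (i + 1) j)

end MatrixResolution

theorem gradedBetti_of_neg {k : Type*} [Field k] {σ : Type*} (I : Ideal (MvPolynomial σ k))
    {i j : ℤ} (h : i < 0 ∨ j < 0) : gradedBetti I i j = 0 := by
  unfold gradedBetti
  split_ifs with h1 h2
  · have : IsEmpty {b : Fin (h1.some.rank i.toNat) // (h1.some.deg i.toNat b : ℤ) = j} :=
      ⟨fun b => by have := b.2; omega⟩
    exact Nat.card_of_isEmpty
  all_goals rfl

end Betti
-- The mapping cone resolution of `I + x J`
section Cone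

open Matrix MvPolynomial

section Blocks

variable {S g g' h h' l : Type*} [CommRing S]

open Classical in
/-- The differential of the mapping cone of `(x, -φ) : G → G ⊕ H` without the component `G → G`. -/
noncomputable def coneMatrix (D : Matrix g g' S) (E : Matrix h h' S) (x : S) (φ : Matrix h g S) :
    Matrix (g ⊕ h) ((g' ⊕ h') ⊕ g) S :=
  fromCols (fromBlocks D 0 0 E) (fromRows (x • 1) (-φ))

theorem coneMatrix_mulVec [Fintype g] [Fintype g'] [Fintype h'] (D : Matrix g g' S)
    (E : Matrix h h' S) (x : S) (φ : Matrix h g S) (u : g' → S) (v : h' → S) (w : g → S) :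
    coneMatrix D E x φ *ᵥ Sum.elim (Sum.elim u v) w =
      Sum.elim (D *ᵥ u + x • w) (E *ᵥ v - φ *ᵥ w) := by
  classical
  rw [coneMatrix, fromCols_mulVec_sumElim, fromBlocks_mulVec, fromRows_mulVec]
  ext1 (b | b) <;> simp [smul_mulVec, neg_mulVec, sub_eq_add_neg]

/-- The differential of the mapping cone of `(x, -φ) : G → G ⊕ H`. -/
noncomputable def fullConeMatrix (D : Matrix g g' S) (E : Matrix h h' S) (x : S) (φ : Matrix h g S)
    (D' : Matrix l g S) : Matrix ((g ⊕ h) ⊕ l) ((g' ⊕ h') ⊕ g) S :=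
  fromRows (coneMatrix D E x φ) (fromCols 0 (-D'))

theorem fullConeMatrix_mulVec [Fintype g] [Fintype g'] [Fintype h'] (D : Matrix g g' S)
    (E : Matrix h h' S) (x : S) (φ : Matrix h g S) (D' : Matrix l g S) (u : g' → S) (v : h' → S)
    (w : g → S) :
    fullConeMatrix D E x φ D' *ᵥ Sum.elim (Sum.elim u v) w =
      Sum.elim (Sum.elim (D *ᵥ u + x • w) (E *ᵥ v - φ *ᵥ w)) (-(D' *ᵥ w)) := by
  rw [fullConeMatrix, fromRows_mulVec, coneMatrix_mulVec, fromCols_mulVec_sumElim]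
  simp [neg_mulVec]

theorem exists_eq_sumElim {α β γ : Type*} (v : (α ⊕ β) → γ) : ∃ s t, v = Sum.elim s t :=
  ⟨_, _, (Sum.elim_comp_inl_inr v).symm⟩

end Blocks

variable {k : Type*} [Field k] {σ : Type*}

theorem isGradedMatrix_coneMatrix {g g' h h' : Type*} {D : Matrix g g' (MvPolynomial σ k)}
    {E : Matrix h h' (MvPolynomial σ k)} {x : MvPolynomial σ k} {φ : Matrix h g (MvPolynomial σ k)}
    {eg : g → ℕ} {eg' : g' → ℕ} {eh : h → ℕ} {eh' : h' → ℕ} (hD : IsGradedMatrix eg eg' D)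
    (hE : IsGradedMatrix eh eh' E) (hφ : IsGradedMatrix eh eg φ)
    (hx : ∀ u ∈ x.support, u.degree = 1) :
    IsGradedMatrix (Sum.elim eg fun b => eh b + 1)
      (Sum.elim (Sum.elim eg' fun b => eh' b + 1) fun b => eg b + 1) (coneMatrix D E x φ) := by
  classical
  rintro (c | c) ((b | b) | b) u hu <;> simp [coneMatrix, Matrix.one_apply] at hu ⊢
  · exact hD c b u (mem_support_iff.2 hu)
  · split_ifs at hu with hcb
    · rw [hcb, hx u (mem_support_iff.2 hu), add_comm]
    · simp at hu
  · have := hE c b u (mem_support_iff.2 hu)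
    omega
  · have := hφ c b u (mem_support_iff.2 hu)
    omega

theorem constantCoeff_coneMatrix {g g' h h' : Type*} {D : Matrix g g' (MvPolynomial σ k)}
    {E : Matrix h h' (MvPolynomial σ k)} {x : MvPolynomial σ k} {φ : Matrix h g (MvPolynomial σ k)}
    (hD : ∀ c b, constantCoeff (D c b) = 0) (hE : ∀ c b, constantCoeff (E c b) = 0)
    (hφ : ∀ c b, constantCoeff (φ c b) = 0) (hx : constantCoeff x = 0) (c b) :
    constantCoeff (coneMatrix D E x φ c b) = 0 := by
  classical
  rcases c with c | c <;> rcases b with (b | b) | b <;>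
    simp [coneMatrix, Matrix.one_apply, hD, hE, hφ, apply_ite, hx]

theorem isGradedMatrix_fullConeMatrix {g g' h h' l : Type*} {D : Matrix g g' (MvPolynomial σ k)}
    {E : Matrix h h' (MvPolynomial σ k)} {x : MvPolynomial σ k} {φ : Matrix h g (MvPolynomial σ k)}
    {D' : Matrix l g (MvPolynomial σ k)}
    {eg : g → ℕ} {eg' : g' → ℕ} {eh : h → ℕ} {eh' : h' → ℕ} {el : l → ℕ}
    (hD : IsGradedMatrix eg eg' D)
    (hE : IsGradedMatrix eh eh' E) (hφ : IsGradedMatrix eh eg φ)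
    (hx : ∀ u ∈ x.support, u.degree = 1) (hD' : IsGradedMatrix el eg D') :
    IsGradedMatrix (Sum.elim (Sum.elim eg fun b => eh b + 1) fun b => el b + 1)
      (Sum.elim (Sum.elim eg' fun b => eh' b + 1) fun b => eg b + 1)
      (fullConeMatrix D E x φ D') := by
  rintro (c | c) b u hu
  · exact isGradedMatrix_coneMatrix hD hE hφ hx c b u hu
  · rcases b with b | b <;> simp [fullConeMatrix] at hu ⊢
    have := hD' c b u (mem_support_iff.2 hu)
    omega

theorem constantCoeff_fullConeMatrix {g g' h h' l : Type*} {D : Matrix g g' (MvPolynomial σ k)}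
    {E : Matrix h h' (MvPolynomial σ k)} {x : MvPolynomial σ k} {φ : Matrix h g (MvPolynomial σ k)}
    {D' : Matrix l g (MvPolynomial σ k)}
    (hD : ∀ c b, constantCoeff (D c b) = 0) (hE : ∀ c b, constantCoeff (E c b) = 0)
    (hφ : ∀ c b, constantCoeff (φ c b) = 0) (hx : constantCoeff x = 0)
    (hD' : ∀ c b, constantCoeff (D' c b) = 0) (c b) :
    constantCoeff (fullConeMatrix D E x φ D' c b) = 0 := by
  rcases c with c | c
  · exact constantCoeff_coneMatrix hD hE hφ hx c b
  · rcases b with b | b <;> simp [fullConeMatrix, hD']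

namespace MatrixResolution

variable {I J : Ideal (MvPolynomial σ k)}

/-- The data for the mapping cone resolution of `I + x J`: a comparison map over `I ⊆ J` with
entries in the ideal generated by the variables, and a linear form `x` regular modulo `I`. -/
structure ConeData (G : MatrixResolution I) (H : MatrixResolution J) where
  x : MvPolynomial σ k
  x_ne_zero : x ≠ 0
  degree_x : ∀ u ∈ x.support, u.degree = 1
  mem_of_x_mul_mem : ∀ p, x * p ∈ I → p ∈ I
  φ : ∀ i, Matrix (H.ι i) (G.ι i) (MvPolynomial σ k)
  φ_zero : φ 0 = Matrix.of (fun _ _ => 1)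
  φ_graded : ∀ i, IsGradedMatrix (H.deg i) (G.deg i) (φ i)
  φ_minimal : ∀ i b c, constantCoeff (φ (i + 1) b c) = 0
  φ_comm : ∀ i, H.d i * φ (i + 1) = φ i * G.d i

namespace ConeData

variable {G : MatrixResolution I} {H : MatrixResolution J} (A : ConeData G H)

theorem constantCoeff_x : constantCoeff A.x = 0 := by
  rw [constantCoeff_eq, ← notMem_support_iff]
  intro h
  simpa using A.degree_x 0 h

theorem d_mulVec_φ_mulVec (i : ℕ) (v : G.ι (i + 1) → MvPolynomial σ k) :
    H.d i *ᵥ (A.φ (i + 1) *ᵥ v) = A.φ i *ᵥ (G.d i *ᵥ v) := by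
  rw [mulVec_mulVec, A.φ_comm, ← mulVec_mulVec]

theorem d_mulVec_d_mulVec {I : Ideal (MvPolynomial σ k)} (G : MatrixResolution I) (i : ℕ)
    (v : G.ι (i + 2) → MvPolynomial σ k) : G.d i *ᵥ (G.d (i + 1) *ᵥ v) = 0 := by
  rw [mulVec_mulVec, G.d_mul_d, zero_mulVec]

/-- The differential of the cone in homological degree `0`. -/
noncomputable def d₀ : Matrix (G.ι 0) (G.ι 1 ⊕ H.ι 1) (MvPolynomial σ k) :=
  -- The reindexing identifies the one-element bases `G.ι 0` and `H.ι 0` of `S`.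
  fromCols (G.d 0) (A.x • (H.d 0).submatrix (fun _ => default) id)

theorem d₀_mulVec (u : G.ι 1 → MvPolynomial σ k) (v : H.ι 1 → MvPolynomial σ k) :
    A.d₀ *ᵥ Sum.elim u v = G.d 0 *ᵥ u + A.x • fun _ => (H.d 0 *ᵥ v) default := by
  rw [d₀, fromCols_mulVec_sumElim, smul_mulVec]
  rfl

theorem span_range_d₀ :
    Ideal.span (Set.range (A.d₀ default)) = I ⊔ Ideal.span {A.x} * J := by
  have h1 : Set.range (A.d₀ default) =
      Set.range (G.d 0 default) ∪ (A.x * ·) '' Set.range (H.d 0 default) := by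
    rw [← Set.range_comp, ← Set.Sum.elim_range]
    congr 1
  rw [h1, Ideal.span_union, G.span_range, ← Set.singleton_mul, ← Ideal.span_mul_span',
    H.span_range]

theorem d₀_mul : A.d₀ * coneMatrix (G.d 1) (H.d 1) A.x (A.φ 1) = 0 := by
  refine mul_eq_zero_of_mulVec fun v => ?_
  obtain ⟨v, w, rfl⟩ := exists_eq_sumElim v
  obtain ⟨s, t, rfl⟩ := exists_eq_sumElim v
  rw [coneMatrix_mulVec, d₀_mulVec, mulVec_add, mulVec_sub, d_mulVec_d_mulVec, d_mulVec_d_mulVec,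
    A.d_mulVec_φ_mulVec, mulVec_smul]
  ext1 c
  have h1 : ∀ v, (A.φ 0 *ᵥ v) default = v default := fun v => by
    simp [A.φ_zero, mulVec, dotProduct]
  simp only [Pi.add_apply, Pi.sub_apply, Pi.smul_apply, Pi.zero_apply, h1, Unique.eq_default c,
    zero_add, zero_sub, smul_eq_mul]
  ring

theorem isGradedMatrix_d₀ :
    IsGradedMatrix (G.deg 0) (Sum.elim (G.deg 1) fun b => H.deg 1 b + 1) A.d₀ := by
  classical
  rintro c (b | b) u hu
  · exact G.graded 0 c b u hu
  · obtain ⟨u₁, h₁, u₂, h₂, rfl⟩ := Finset.mem_add.1 (support_mul A.x (H.d 0 default b) hu)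
    have h3 := H.graded 0 default b u₂ h₂
    rw [H.deg_zero] at h3
    rw [map_add, A.degree_x u₁ h₁, G.deg_zero, Sum.elim_inr, ← h3]
    ring

theorem cone_mul (i : ℕ) : coneMatrix (G.d (i + 1)) (H.d (i + 1)) A.x (A.φ (i + 1)) *
    fullConeMatrix (G.d (i + 2)) (H.d (i + 2)) A.x (A.φ (i + 2)) (G.d (i + 1)) = 0 := by
  refine mul_eq_zero_of_mulVec fun v => ?_
  obtain ⟨v, w, rfl⟩ := exists_eq_sumElim v
  obtain ⟨s, t, rfl⟩ := exists_eq_sumElim v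
  rw [fullConeMatrix_mulVec, coneMatrix_mulVec]
  simp only [mulVec_add, mulVec_sub, mulVec_neg, d_mulVec_d_mulVec, A.d_mulVec_φ_mulVec,
    mulVec_smul]
  simp

theorem fullCone_mul (i : ℕ) :
    fullConeMatrix (G.d (i + 2)) (H.d (i + 2)) A.x (A.φ (i + 2)) (G.d (i + 1)) *
    fullConeMatrix (G.d (i + 3)) (H.d (i + 3)) A.x (A.φ (i + 3)) (G.d (i + 2)) = 0 := by
  refine mul_eq_zero_of_mulVec fun v => ?_
  obtain ⟨v, w, rfl⟩ := exists_eq_sumElim v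
  obtain ⟨s, t, rfl⟩ := exists_eq_sumElim v
  rw [fullConeMatrix_mulVec, fullConeMatrix_mulVec]
  simp only [mulVec_add, mulVec_sub, mulVec_neg, d_mulVec_d_mulVec, A.d_mulVec_φ_mulVec,
    mulVec_smul]
  simp

/-- This is `I ∩ xJ = xI`. From `d s + x d t = 0`, regularity of `x` modulo `I` gives `-d t = d s₁`
in `I`; then `s - x s₁` and `t + φ s₁` are cycles, hence boundaries. -/
theorem d₀_exact (v : G.ι 1 ⊕ H.ι 1 → MvPolynomial σ k) (hv : A.d₀ *ᵥ v = 0) :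
    ∃ w, coneMatrix (G.d 1) (H.d 1) A.x (A.φ 1) *ᵥ w = v := by
  obtain ⟨s, t, rfl⟩ := exists_eq_sumElim v
  rw [d₀_mulVec] at hv
  have h1 : A.x * -(H.d 0 *ᵥ t) default = (G.d 0 *ᵥ s) default := by
    have := congrFun hv default
    simp only [Pi.add_apply, Pi.smul_apply, smul_eq_mul, Pi.zero_apply] at this
    linear_combination -this
  have h2 : -(H.d 0 *ᵥ t) default ∈ I := by
    refine A.mem_of_x_mul_mem _ (h1 ▸ G.mem_iff.2 ⟨s, ?_⟩)
    ext1 c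
    rw [Unique.eq_default c]
  obtain ⟨s₁, hs₁⟩ := G.mem_iff.1 h2
  obtain ⟨s₂, hs₂⟩ := G.exact 0 (s - A.x • s₁) (by
    rw [mulVec_sub, mulVec_smul, hs₁]
    ext1 c
    rw [Unique.eq_default c]
    simp [← h1])
  obtain ⟨t₂, ht₂⟩ := H.exact 0 (t + A.φ 1 *ᵥ s₁) (by
    rw [mulVec_add, A.d_mulVec_φ_mulVec, hs₁, A.φ_zero]
    ext1 c
    rw [Unique.eq_default c]
    simp [mulVec, dotProduct])
  refine ⟨Sum.elim (Sum.elim s₂ t₂) s₁, ?_⟩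
  rw [coneMatrix_mulVec, hs₂, ht₂]
  simp

/-- The row `-d w = 0` of the full cone need not be assumed: applying `d` to `d s + x w = 0` gives
`x d w = 0`, and `x` is a nonzero element of a domain. So one argument serves index `1`, where that
row is absent, and all higher indices. -/
theorem cone_exact (i : ℕ) (v : (G.ι (i + 2) ⊕ H.ι (i + 2)) ⊕ G.ι (i + 1) → MvPolynomial σ k)
    (hv : coneMatrix (G.d (i + 1)) (H.d (i + 1)) A.x (A.φ (i + 1)) *ᵥ v = 0) :
    ∃ w, fullConeMatrix (G.d (i + 2)) (H.d (i + 2)) A.x (A.φ (i + 2)) (G.d (i + 1)) *ᵥ w = v := by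
  obtain ⟨v, w, rfl⟩ := exists_eq_sumElim v
  obtain ⟨s, t, rfl⟩ := exists_eq_sumElim v
  rw [coneMatrix_mulVec] at hv
  have h1 : G.d (i + 1) *ᵥ s + A.x • w = 0 := by
    ext1 c
    exact congrFun hv (Sum.inl c)
  have h2 : H.d (i + 1) *ᵥ t - A.φ (i + 1) *ᵥ w = 0 := by
    ext1 c
    exact congrFun hv (Sum.inr c)
  have h3 : G.d i *ᵥ w = 0 := by
    have := congrArg (G.d i *ᵥ ·) h1
    simp only [mulVec_add, mulVec_smul, d_mulVec_d_mulVec, zero_add, mulVec_zero] at this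
    exact (smul_eq_zero.1 this).resolve_left A.x_ne_zero
  obtain ⟨w₁, hw₁⟩ := G.exact i w h3
  obtain ⟨s₂, hs₂⟩ := G.exact (i + 1) (s + A.x • w₁) (by rw [mulVec_add, mulVec_smul, hw₁, h1])
  obtain ⟨t₂, ht₂⟩ := H.exact (i + 1) (t - A.φ (i + 2) *ᵥ w₁) (by
    rw [mulVec_sub, A.d_mulVec_φ_mulVec, hw₁, h2])
  refine ⟨Sum.elim (Sum.elim s₂ t₂) (-w₁), ?_⟩
  rw [fullConeMatrix_mulVec, hs₂, ht₂, mulVec_neg, mulVec_neg, hw₁]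
  simp

/-- The mapping cone resolution of `I + x J`. -/
noncomputable def cone : MatrixResolution (I ⊔ Ideal.span {A.x} * J) where
  -- The cone is taken of the resolutions of `I` and `J`, which start at index `1`; hence no copy of
  -- `G.ι 0` at index `1`.
  ι := fun | 0 => G.ι 0 | 1 => G.ι 1 ⊕ H.ι 1 | i + 2 => (G.ι (i + 2) ⊕ H.ι (i + 2)) ⊕ G.ι (i + 1)
  fintype := fun | 0 => inferInstanceAs (Fintype (G.ι 0))
                 | 1 => inferInstanceAs (Fintype (G.ι 1 ⊕ H.ι 1))
                 | i + 2 => inferInstanceAs (Fintype ((G.ι (i + 2) ⊕ H.ι (i + 2)) ⊕ G.ι (i + 1)))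
  unique := inferInstanceAs (Unique (G.ι 0))
  deg := fun
    | 0 => G.deg 0
    | 1 => Sum.elim (G.deg 1) fun b => H.deg 1 b + 1
    | i + 2 => Sum.elim (Sum.elim (G.deg (i + 2)) fun b => H.deg (i + 2) b + 1)
        fun b => G.deg (i + 1) b + 1
  d := fun
    | 0 => A.d₀
    | 1 => coneMatrix (G.d 1) (H.d 1) A.x (A.φ 1)
    | i + 2 => fullConeMatrix (G.d (i + 2)) (H.d (i + 2)) A.x (A.φ (i + 2)) (G.d (i + 1))
  deg_zero := G.deg_zero
  span_range := A.span_range_d₀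
  graded
    | 0 => A.isGradedMatrix_d₀
    | 1 => isGradedMatrix_coneMatrix (G.graded 1) (H.graded 1) (A.φ_graded 1) A.degree_x
    | i + 2 => isGradedMatrix_fullConeMatrix (G.graded (i + 2)) (H.graded (i + 2))
        (A.φ_graded (i + 2)) A.degree_x (G.graded (i + 1))
  d_mul_d
    | 0 => A.d₀_mul
    | 1 => A.cone_mul 0
    | i + 2 => A.fullCone_mul i
  exact
    | 0 => A.d₀_exact
    | 1 => A.cone_exact 0
    | i + 2 => fun v hv => A.cone_exact (i + 1) v (by
        ext1 c
        exact congrFun hv (Sum.inl c))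
  minimal
    | 0 => constantCoeff_coneMatrix (G.minimal 0) (H.minimal 0) (A.φ_minimal 0) A.constantCoeff_x
    | i + 1 => constantCoeff_fullConeMatrix (G.minimal (i + 1)) (H.minimal (i + 1))
        (A.φ_minimal (i + 1)) A.constantCoeff_x (G.minimal i)

theorem card_deg_one_cone (j : ℕ) : Nat.card {b // A.cone.deg 1 b = j} =
    Nat.card {b // G.deg 1 b = j} + Nat.card {b // H.deg 1 b + 1 = j} := by
  rw [← Nat.card_sum]
  exact Nat.card_congr Equiv.subtypeSum

theorem card_deg_cone (i j : ℕ) : Nat.card {b // A.cone.deg (i + 2) b = j} =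
    Nat.card {b // G.deg (i + 2) b = j} + Nat.card {b // H.deg (i + 2) b + 1 = j} +
      Nat.card {b // G.deg (i + 1) b + 1 = j} := by
  rw [← Nat.card_sum, ← Nat.card_sum]
  exact Nat.card_congr (Equiv.subtypeSum.trans (Equiv.sumCongr Equiv.subtypeSum (Equiv.refl _)))

end ConeData

end MatrixResolution

end Cone
-- Setting variables to zero, and comparison maps without constant terms
section KillVars

open Matrix MvPolynomial

variable {k : Type*} [Field k] {σ τ : Type*} (Z : Set σ)

open Classical in
/-- The retraction of a polynomial ring that sends the variables in `Z` to `0`. -/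
noncomputable def killVars : MvPolynomial σ k →ₐ[k] MvPolynomial σ k :=
  aeval fun s => if s ∈ Z then 0 else X s

variable {Z}

theorem killVars_X_of_mem {s : σ} (hs : s ∈ Z) : killVars Z (X s : MvPolynomial σ k) = 0 := by
  simp [killVars, hs]

theorem killVars_X_of_notMem {s : σ} (hs : s ∉ Z) :
    killVars Z (X s : MvPolynomial σ k) = X s := by
  simp [killVars, hs]

theorem killVars_rename {f : τ → σ} (hf : ∀ t, f t ∉ Z) (p : MvPolynomial τ k) :
    killVars Z (rename f p) = rename f p := by
  have : (killVars Z : MvPolynomial σ k →ₐ[k] _).comp (rename f) = rename f := by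
    ext1 t
    simp [killVars_X_of_notMem (hf t)]
  exact DFunLike.congr_fun this p

theorem killVars_killVars (p : MvPolynomial σ k) : killVars Z (killVars Z p) = killVars Z p := by
  have : (killVars Z : MvPolynomial σ k →ₐ[k] _).comp (killVars Z) = killVars Z := by
    ext1 t
    by_cases h : t ∈ Z
    · simp [killVars_X_of_mem h]
    · simp [killVars_X_of_notMem h]
  exact DFunLike.congr_fun this p

theorem constantCoeff_killVars (p : MvPolynomial σ k) :
    constantCoeff (killVars Z p) = constantCoeff p := by
  induction p using MvPolynomial.induction_on with
  | C a => simp [killVars]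
  | add p q hp hq => rw [map_add, map_add, map_add, hp, hq]
  | mul_X p s _ =>
    by_cases h : s ∈ Z
    · simp [killVars_X_of_mem h]
    · simp [killVars_X_of_notMem h]

theorem X_dvd_sub_killVars (s : σ) (p : MvPolynomial σ k) : X s ∣ p - killVars {s} p := by
  induction p using MvPolynomial.induction_on with
  | C a => simp [killVars]
  | add p q hp hq =>
    rw [map_add, add_sub_add_comm]
    exact dvd_add hp hq
  | mul_X p t hp =>
    by_cases h : t = s
    · subst h
      simp [killVars_X_of_mem (Set.mem_singleton t)]
    · rw [map_mul, killVars_X_of_notMem (by simpa using h), ← sub_mul]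
      exact hp.mul_right _

theorem killVars_monomial (u : σ →₀ ℕ) (a : k) :
    killVars Z (monomial u a) = monomial u a ∨ killVars Z (monomial u a) = 0 := by
  rw [monomial_eq, map_mul, Finsupp.prod, map_prod]
  by_cases h : ∃ s ∈ u.support, s ∈ Z
  · obtain ⟨s, hs, hsZ⟩ := h
    right
    rw [Finset.prod_eq_zero hs, mul_zero]
    rw [map_pow, killVars_X_of_mem hsZ, zero_pow (Finsupp.mem_support_iff.1 hs)]
  · left
    push Not at h
    congr 1
    · simp [killVars]
    · exact Finset.prod_congr rfl fun s hs => by rw [map_pow, killVars_X_of_notMem (h s hs)]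

/-- Each monomial is kept or killed, so degrees are preserved. This makes the kernel of `killVars`
homogeneous, as `exists_comparison` requires of `𝔞`. -/
theorem killVars_shiftedComponent (e j : ℕ) (p : MvPolynomial σ k) :
    killVars Z (shiftedComponent e j p) = shiftedComponent e j (killVars Z p) := by
  induction p using MvPolynomial.induction_on' with
  | add p q hp hq => simp only [map_add, hp, hq]
  | monomial u a =>
    have h1 : shiftedComponent e j (monomial u a) = if u.degree + e = j then monomial u a else 0 := by
      classical
      ext v
      rw [coeff_shiftedComponent]
      by_cases h : u = v
      · subst h
        split_ifs <;> simp
      · split_ifs <;> simp [h]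
    rcases killVars_monomial (Z := Z) u a with h | h
    · rw [h, h1]
      split_ifs
      · exact h
      · exact map_zero _
    · rw [h, h1, map_zero]
      split_ifs
      · exact h
      · exact map_zero _

theorem killVars_mulVec {κ ι : Type*} [Fintype ι] {M : Matrix κ ι (MvPolynomial σ k)}
    (hM : ∀ c b, killVars Z (M c b) = M c b) (w : ι → MvPolynomial σ k) (c : κ) :
    (M *ᵥ fun b => killVars Z (w b)) c = killVars Z ((M *ᵥ w) c) := by
  simp [mulVec, dotProduct, hM]

/-- If the entries of `M` do not involve the variable `s`, then `X s` is regular modulo the image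
of `M`. -/
theorem exists_mulVec_eq_of_X_smul {κ ι : Type*} [Fintype ι] {M : Matrix κ ι (MvPolynomial σ k)}
    {s : σ} (hM : ∀ c b, killVars {s} (M c b) = M c b) {v : κ → MvPolynomial σ k}
    {w : ι → MvPolynomial σ k} (h : M *ᵥ w = (X s : MvPolynomial σ k) • v) :
    ∃ w', M *ᵥ w' = v := by
  -- Setting `X s = 0` in `w` gives a vector killed by `M`, because `X s • v` becomes zero. Subtract
  -- it and divide by `X s`.
  choose w' hw' using fun b => X_dvd_sub_killVars s (w b)
  refine ⟨w', ?_⟩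
  have h1 : (X s : MvPolynomial σ k) • (M *ᵥ w') = (X s : MvPolynomial σ k) • v := by
    rw [← mulVec_smul, show (X s : MvPolynomial σ k) • w' = w - fun b => killVars {s} (w b) from
      funext fun b => (hw' b).symm, mulVec_sub, h, sub_eq_self]
    ext1 c
    rw [killVars_mulVec hM, h, Pi.smul_apply, smul_eq_mul, map_mul,
      killVars_X_of_mem (Set.mem_singleton s), zero_mul, Pi.zero_apply]
  exact smul_right_injective _ (X_ne_zero s) h1

/-- If the entries of `M` and `N` do not involve the variables in `Z`, then exactness is inherited
by vectors that vanish on setting these variables to `0`. -/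
theorem exists_mulVec_eq_of_killVars {κ ι : Type*} [Fintype ι]
    {M : Matrix κ ι (MvPolynomial σ k)} (hM : ∀ c b, killVars Z (M c b) = M c b)
    {v : κ → MvPolynomial σ k} (hv : ∀ c, killVars Z (v c) = 0) (h : ∃ w, M *ᵥ w = v) :
    ∃ w : ι → MvPolynomial σ k, (∀ b, killVars Z (w b) = 0) ∧ M *ᵥ w = v := by
  obtain ⟨w, rfl⟩ := h
  -- The subtracted vector is mapped by `M` to `killVars Z` of `v`, which is zero.
  refine ⟨w - fun b => killVars Z (w b), fun b => ?_, ?_⟩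
  · rw [Pi.sub_apply, map_sub, killVars_killVars, sub_self]
  · rw [mulVec_sub, sub_eq_self]
    ext1 c
    rw [killVars_mulVec hM, hv, Pi.zero_apply]

theorem MatrixResolution.killVars_baseChange_d {I : Ideal (MvPolynomial τ k)}
    (R : MatrixResolution I) {f : τ → σ} (hf : Function.Injective f) (hZ : ∀ t, f t ∉ Z) (i : ℕ)
    (c b) : killVars Z ((R.baseChange hf).d i c b) = (R.baseChange hf).d i c b :=
  killVars_rename hZ (R.d i c b)

/-- Take for `𝔞` the kernel of `killVars Z`, generated by the variables in `Z`. Since `H` avoids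
`Z`, its subcomplex with coefficients in `𝔞` is exact, and `I ⊆ 𝔞J` starts the lifting inside it.
Since `G.d 0` avoids `s`, `X s` is regular modulo `I`. -/
theorem MatrixResolution.exists_coneData {I J : Ideal (MvPolynomial σ k)} (G : MatrixResolution I)
    (H : MatrixResolution J) {s : σ} (hG : ∀ c b, killVars {s} (G.d 0 c b) = G.d 0 c b)
    (hH : ∀ i c b, killVars Z (H.d i c b) = H.d i c b)
    (hIJ : I ≤ RingHom.ker (killVars Z : MvPolynomial σ k →ₐ[k] MvPolynomial σ k) * J) :
    ∃ A : G.ConeData H, A.x = X s := by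
  have hK : ∀ p ∈ I, ∃ w : H.ι 1 → MvPolynomial σ k,
      (∀ c, w c ∈ RingHom.ker (killVars Z : MvPolynomial σ k →ₐ[k] MvPolynomial σ k)) ∧
        H.d 0 *ᵥ w = fun _ => p := by
    intro p hp
    refine Submodule.mul_induction_on (hIJ hp) (fun r hr q hq => ?_) fun p q hp hq => ?_
    · obtain ⟨w, hw⟩ := H.mem_iff.1 hq
      refine ⟨r • w, fun c => Ideal.mul_mem_right _ _ hr, ?_⟩
      rw [mulVec_smul, hw]
      rfl
    · obtain ⟨v, hv, hv'⟩ := hp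
      obtain ⟨w, hw, hw'⟩ := hq
      refine ⟨v + w, fun c => Ideal.add_mem _ (hv c) (hw c), ?_⟩
      rw [mulVec_add, hv', hw']
      rfl
  obtain ⟨φ, hφ0, hφg, hφZ, hφ⟩ := G.exists_comparison H
    (𝔞 := RingHom.ker (killVars Z : MvPolynomial σ k →ₐ[k] MvPolynomial σ k))
    (fun p hp i j => by
      rw [RingHom.mem_ker, killVars_shiftedComponent, RingHom.mem_ker.1 hp, map_zero])
    hK (fun i v hv h => exists_mulVec_eq_of_killVars (hH (i + 1)) hv (H.exact i v h))
  refine ⟨{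
    x := X s
    x_ne_zero := X_ne_zero _
    degree_x := fun u hu => ?_
    mem_of_x_mul_mem := fun p hp => ?_
    φ := φ
    φ_zero := hφ0
    φ_graded := hφg
    φ_minimal := fun i b c => ?_
    φ_comm := hφ }, rfl⟩
  · rw [support_X, Finset.mem_singleton] at hu
    simp [hu]
  · obtain ⟨w, hw⟩ := G.mem_iff.1 hp
    exact G.mem_iff.2 (exists_mulVec_eq_of_X_smul hG hw)
  · rw [← constantCoeff_killVars (Z := Z), RingHom.mem_ker.1 (hφZ i b c), map_zero]

end KillVars

/-! ### Letterplace ideals and the recursion -/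

section Letterplace

open Matrix MvPolynomial

variable {k : Type*} [Field k]

theorem homogeneousComponent_mem_span_range {σ ι : Type*} [Finite ι] {g : ι → MvPolynomial σ k}
    {e : ι → ℕ} (hg : ∀ t, (g t).IsHomogeneous (e t)) {p : MvPolynomial σ k}
    (hp : p ∈ Ideal.span (Set.range g)) (j : ℕ) :
    homogeneousComponent j p ∈ Ideal.span (Set.range g) := by
  have := Fintype.ofFinite ι
  obtain ⟨c, rfl⟩ := Ideal.mem_span_range_iff_exists_fun.1 hp
  rw [map_sum]
  refine Ideal.sum_mem _ fun t _ => ?_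
  have h1 : homogeneousComponent j (c t * g t) = g t * shiftedComponent (e t) j (c t) := by
    rw [mul_shiftedComponent (e := 0), mul_comm]
    · simp [shiftedComponent]
    · intro u hu
      rw [add_zero, Finsupp.degree_eq_weight_one]
      exact hg t (mem_support_iff.1 hu)
  rw [h1]
  exact Ideal.mul_mem_right _ _ (Ideal.subset_span ⟨t, rfl⟩)

/-- The generator of the letterplace ideal given by a multichain. -/
noncomputable def chainMonomial (k : Type*) [Field k] {n : ℕ} {P : Type*} (c : Fin n → P) :
    MvPolynomial (Fin n × P) k :=
  ∏ q, X (q, c q)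

theorem letterplaceIdeal_eq (n : ℕ) (P : Type*) [PartialOrder P] : letterplaceIdeal k n P =
    Ideal.span (Set.range fun c : Fin n →o P => chainMonomial k c) :=
  rfl

theorem nonempty_minimalGradedFreeResolution_letterplaceIdeal (n : ℕ) (P : Type*) [PartialOrder P]
    [Finite P] : Nonempty (MinimalGradedFreeResolution (letterplaceIdeal k n P)) := by
  have : Finite (Fin n →o P) := DFunLike.finite _
  refine nonempty_minimalGradedFreeResolution _ fun p hp j => ?_
  refine homogeneousComponent_mem_span_range (e := fun _ => n) (fun c => ?_) hp j
  have := IsHomogeneous.prod Finset.univ (fun q : Fin n => (X (q, c q) : MvPolynomial _ k))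
    (fun _ => 1) (fun q _ => isHomogeneous_X k _)
  simpa using this

section

variable {P : Type*} {n : ℕ}

/-- The inclusion of variables for `P ∖ {a} ⊆ P`. -/
def inclVar (a : P) (n : ℕ) : Fin n × {p : P // p ≠ a} → Fin n × P := Prod.map id Subtype.val

/-- The inclusion of variables that raises the first index by one. -/
def succVar (P : Type*) (n : ℕ) : Fin n × P → Fin (n + 1) × P := Prod.map Fin.succ id

theorem inclVar_injective (a : P) (n : ℕ) : Function.Injective (inclVar a n) :=
  Function.injective_id.prodMap Subtype.val_injective

theorem succVar_injective : Function.Injective (succVar P n) :=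
  (Fin.succ_injective n).prodMap Function.injective_id

theorem rename_inclVar_chainMonomial {a : P} (c : Fin n → {p : P // p ≠ a}) :
    rename (inclVar a n) (chainMonomial k c) = chainMonomial k fun q => (c q : P) := by
  simp [chainMonomial, inclVar]

theorem chainMonomial_succ (c : Fin (n + 1) → P) : chainMonomial k c =
    X (0, c 0) * rename (succVar P n) (chainMonomial k fun q => c q.succ) := by
  simp [chainMonomial, succVar, Fin.prod_univ_succ]

variable [PartialOrder P] {a : P}

/-- Multichains are split by their first term. After `a` any multichain may follow, because `a` is
least; if the first term is not `a`, no later term is. -/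
theorem letterplaceIdeal_succ (ha : ∀ p, a ≤ p) : letterplaceIdeal k (n + 1) P =
    (letterplaceIdeal k (n + 1) {p : P // p ≠ a}).map (rename (inclVar a (n + 1))) ⊔
      Ideal.span {(X (0, a) : MvPolynomial (Fin (n + 1) × P) k)} *
        (letterplaceIdeal k n P).map (rename (succVar P n)) := by
  apply le_antisymm
  · rw [letterplaceIdeal_eq, Ideal.span_le]
    rintro _ ⟨c, rfl⟩
    by_cases h : c 0 = a
    · apply Ideal.mem_sup_right
      beta_reduce
      rw [chainMonomial_succ, h]
      refine Ideal.mul_mem_mul (Ideal.mem_span_singleton_self _) (Ideal.mem_map_of_mem _ ?_)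
      exact Ideal.subset_span ⟨⟨fun q => c q.succ, fun q r hqr =>
        c.monotone (Fin.succ_le_succ_iff.2 hqr)⟩, rfl⟩
    · apply Ideal.mem_sup_left
      have h1 : ∀ q, c q ≠ a := fun q hq =>
        h (((c.monotone (Fin.zero_le q)).trans hq.le).antisymm (ha _))
      have h2 := rename_inclVar_chainMonomial (k := k) fun q => (⟨c q, h1 q⟩ : {p : P // p ≠ a})
      beta_reduce
      refine h2 ▸ Ideal.mem_map_of_mem _ (Ideal.subset_span ⟨⟨fun q => ⟨c q, h1 q⟩, ?_⟩, rfl⟩)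
      exact fun q r hqr => c.monotone hqr
  · apply sup_le
    · rw [letterplaceIdeal_eq, Ideal.map_span, Ideal.span_le]
      rintro _ ⟨_, ⟨c, rfl⟩, rfl⟩
      refine Ideal.subset_span ⟨⟨fun q => (c q : P), fun q r hqr => c.monotone hqr⟩, ?_⟩
      exact (rename_inclVar_chainMonomial (k := k) c).symm
    · rw [letterplaceIdeal_eq, Ideal.map_span, Ideal.span_mul_span', Ideal.span_le]
      rintro _ ⟨_, rfl, _, ⟨_, ⟨c, rfl⟩, rfl⟩, rfl⟩
      refine Ideal.subset_span ⟨⟨Fin.cons a c, fun q r hqr => ?_⟩, ?_⟩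
      · induction q using Fin.cases with
        | zero => exact ha _
        | succ q =>
          induction r using Fin.cases with
          | zero => exact absurd hqr (by simp)
          | succ r => exact c.monotone (Fin.succ_le_succ_iff.1 hqr)
      · exact chainMonomial_succ _

/-- Splitting the first factor off a generator leaves a generator for the remaining multichain,
which lies in all of `P`. -/
theorem map_letterplaceIdeal_le :
    (letterplaceIdeal k (n + 1) {p : P // p ≠ a}).map (rename (inclVar a (n + 1))) ≤
      RingHom.ker (killVars (Prod.fst ⁻¹' {0}) : MvPolynomial (Fin (n + 1) × P) k →ₐ[k] _) *
        (letterplaceIdeal k n P).map (rename (succVar P n)) := by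
  rw [letterplaceIdeal_eq, Ideal.map_span, Ideal.span_le]
  rintro _ ⟨_, ⟨c, rfl⟩, rfl⟩
  beta_reduce
  rw [rename_inclVar_chainMonomial, chainMonomial_succ]
  refine Ideal.mul_mem_mul (RingHom.mem_ker.2 (killVars_X_of_mem rfl)) (Ideal.mem_map_of_mem _ ?_)
  exact Ideal.subset_span ⟨⟨fun q => (c q.succ : P), fun q r hqr =>
    c.monotone (Fin.succ_le_succ_iff.2 hqr)⟩, rfl⟩

theorem exists_coneData_letterplaceIdeal
    (G : MatrixResolution (letterplaceIdeal k (n + 1) {p : P // p ≠ a}))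
    (H : MatrixResolution (letterplaceIdeal k n P)) :
    ∃ A : (G.baseChange (inclVar_injective a (n + 1))).ConeData
      (H.baseChange (succVar_injective (P := P) (n := n))), A.x = X (0, a) := by
  have hG := G.killVars_baseChange_d (Z := {((0 : Fin (n + 1)), a)})
    (inclVar_injective a (n + 1)) (fun t ht => t.2.2 (congrArg Prod.snd ht)) 0
  have hH := H.killVars_baseChange_d (Z := Prod.fst ⁻¹' {(0 : Fin (n + 1))})
    (succVar_injective (P := P) (n := n)) fun t ht => Fin.succ_ne_zero t.1 ht
  exact MatrixResolution.exists_coneData _ _ hG hH map_letterplaceIdeal_le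

end

theorem card_deg_add_one_eq_gradedBetti {σ : Type*} [Finite σ] {I : Ideal (MvPolynomial σ k)}
    (R : MatrixResolution I) (i j : ℕ) :
    Nat.card {b // R.deg (i + 1) b + 1 = j} = gradedBetti I i (j - 1) := by
  cases j with
  | zero =>
    rw [gradedBetti_of_neg I (Or.inr (by simp))]
    simp
  | succ j =>
    simp only [Nat.add_right_cancel_iff, Nat.cast_add, Nat.cast_one, add_sub_cancel_right]
    exact (R.gradedBetti_eq i j).symm

theorem gradedBetti_letterplaceIdeal_succ {P : Type*} [PartialOrder P] [Finite P] {a : P}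
    (ha : ∀ p, a ≤ p) (n : ℕ) (i j : ℤ) :
    gradedBetti (letterplaceIdeal k (n + 1) P) i j =
      gradedBetti (letterplaceIdeal k (n + 1) {p : P // p ≠ a}) i j
        + gradedBetti (letterplaceIdeal k n P) i (j - 1)
        + gradedBetti (letterplaceIdeal k (n + 1) {p : P // p ≠ a}) (i - 1) (j - 1) := by
  by_cases hij : i < 0 ∨ j < 0
  · rw [gradedBetti_of_neg _ hij, gradedBetti_of_neg _ hij, gradedBetti_of_neg _ (by omega),
      gradedBetti_of_neg _ (by omega)]
  push Not at hij
  lift i to ℕ using hij.1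
  lift j to ℕ using hij.2
  let G := MatrixResolution.ofMinimalGradedFreeResolution
    (nonempty_minimalGradedFreeResolution_letterplaceIdeal (k := k) (n + 1) {p : P // p ≠ a}).some
  let H := MatrixResolution.ofMinimalGradedFreeResolution
    (nonempty_minimalGradedFreeResolution_letterplaceIdeal (k := k) n P).some
  obtain ⟨A, hA⟩ := exists_coneData_letterplaceIdeal G H
  have hI := letterplaceIdeal_succ (k := k) (n := n) ha
  rw [← hA] at hI
  rw [hI, A.cone.gradedBetti_eq, G.gradedBetti_eq, ← card_deg_add_one_eq_gradedBetti H]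
  cases i with
  | zero =>
    -- The term of homological index `-1` matches the missing copy of `G` at index `1` of the cone.
    rw [gradedBetti_of_neg _ (by simp), add_zero]
    exact A.card_deg_one_cone j
  | succ i =>
    rw [Nat.cast_succ, add_sub_cancel_right, ← card_deg_add_one_eq_gradedBetti G]
    exact A.card_deg_cone i j

end Letterplace

theorem corollary4p2 {k : Type*} [Field k] {P : Type*} [PartialOrder P] [Finite P]
    (a : P) (ha : ∀ p : P, IsMin p ↔ p = a) (n : ℕ) (hn : 1 ≤ n) (i j : ℤ) :
    gradedBetti (letterplaceIdeal k n P) i j =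
      gradedBetti (letterplaceIdeal k n {p : P // p ≠ a}) i j
        + gradedBetti (letterplaceIdeal k (n - 1) P) i (j - 1)
        + gradedBetti (letterplaceIdeal k n {p : P // p ≠ a}) (i - 1) (j - 1) := by
  obtain ⟨m, rfl⟩ : ∃ m, n = m + 1 := ⟨n - 1, by omega⟩
  refine gradedBetti_letterplaceIdeal_succ (fun p => ?_) m i j
  -- By finiteness some minimal element lies below `p`, and it must be `a`; so `a` is least.
  obtain ⟨b, hbp, hb⟩ := exists_minimal_le_of_wellFoundedLT (fun _ : P => True) p trivial
  rw [← (ha b).1 (minimal_true.1 hb)]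
  exact hbp
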